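/- Consider the two-stage robust problem $$w^*=\min_{x\in\mathcal X} c_1x+\max_{u\in\mathcal U(x)}\ \min_{y\in\mathcal Y(x,u)} c_2y,$$ where $\mathcal X=\{x\in\mathbb Z_+^{m_x}\times\mathbb R_+^{n_x}: Ax\ge b\}$, $\mathcal U(x)=\{u\in\mathbb R_+^{n_u}: Fu\le h+Gx\}$ (right-hand-side decision dependence, $F$ has $\mu_u$ rows) and $\mathcal Y(x,u)=\{y\in\mathbb R_+^{n_y}: B_2y\ge d-B_1x-Eu\}$. Assume that $\mathcal U(x)$ is nonempty and bounded for every $x\in\mathcal X$, and that $\min\{c_1x+c_2y: x\in\mathcal X,u\in\mathcal U(x),y\in\mathcal Y(x,u)\}$ is finite. Let $\Pi=\{\pi\ge 0: B_2^\top\pi\le c_2^\top\}$, let $\mathbf{LP}(x,\beta)$ be $\max\{(-Eu)^\top\beta: u\in\mathcal U(x)\}$, and let $\mathcal K(x,c)$ be the set of pairs $(u,\lambda)$ that satisfy the KKT conditions of $\max\{cu: u\in\mathcal U(x)\}$. A basis is a set of $\mu_u$ linearly independent columns of $[F\ I]$ (structural and slack variables); an optimal basis of a linear program over $\mathcal U(x)$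 is one whose basic solution is feasible and whose reduced costs are all nonpositive. **Variant 2** with tolerance $TOL\ge 0$ starts with $UB=+\infty$ and no cutting sets and repeats the following iteration. 1. Solve the master problem: minimize $c_1x+\eta$ subject to $x\in\mathcal X$ and, for each previously identified $\beta$ (with its own variables $u,\lambda,y$), $(u,\lambda)\in\mathcal K(x,-(E^\top\beta)^\top)$, $y\in\mathcal Y(x,u)$, $\eta\ge c_2y$. If it is infeasible, stop. Otherwise let $LB$ be its optimal value and $x^*$ the first-stage part of an optimal solution (if it is unbounded, as in the first iteration, $LB=-\infty$ and $x^*$ is any feasible $x$). 2. Compute $\eta_f(x^*)=\max_{u\in\mathcal U(x^*)}\min\{\mathbf 1^\top\tilde y: B_2y+\tilde y\ge d-B_1x^*-Eu,\ y,\tilde y\ge0\}$. If $\eta_f(x^*)=0$, compute the worst-case recourse cost $\eta_s(x^*)=\max_{u\in\mathcal U(x^*)}\min_{y\in\mathcal Y(x^*,u)}c_2y$, a maximizer $u^*$, and an extreme point $\beta$ of $\Pi$ that is an optimal dual solution of the recourse problem for $u^*$. If $\eta_f(x^*)>0$, take an optimal $u^*$ for $\eta_f(x^*)$ and an extreme ray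 $\beta$ of $\Pi$ with $(d-B_1x^*-Eu^*)^\top\beta>0$, and set $\eta_s(x^*)=+\infty$. 3. Extract an optimal basis $\mathfrak B$ of $\mathbf{LP}(x^*,\beta)$ with its reduced costs $r$, and add the cutting set of $\beta$ to the master problem. 4. Set $UB=\min\{UB,\,c_1x^*+\eta_s(x^*)\}$; stop if $UB-LB\le TOL$. The **modified Variant 2** differs only in the objective used in the KKT system of the new cutting set: the coefficients of $\mathbf{LP}(x^*,\beta)$, taken on all $n_u+\mu_u$ structural and slack variables, are lowered by some $\epsilon>0$ at every nonbasic variable with zero reduced cost and are kept otherwise. Let $N$ be the number of bases, which depends only on $F$. Then: (a) If, in an execution of Variant 2, $\mathbf{LP}(x^*,\beta)$ has a unique optimal solution for the decision $x^*$ of each iteration and every $\beta$ identified in that or an earlier iteration, then the number of iterations before termination, i.e. iterations carried out without stopping, is at most $N$. (b) In every execution of the modified Variant 2, without any uniqueness assumption, the number of iterations before termination is at most $N$. (c) $N\le\binom{n_u+\mu_u}{\mu_u}$, so both iteration counts are $O\big(\binom{n_u+\mu_u}{\mu_u}\big)$. -/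

import Mathlib

open Matrix

/-- Data of a two-stage robust optimization problem
`min_{x ∈ X} c₁ x + max_{u ∈ U(x)} min_{y ∈ Y(x,u)} c₂ y`
with continuous recourse and a continuous uncertainty set whose right-hand side depends on `x`.
There are `mx` integer and `nx` continuous first-stage variables and `mA` first-stage constraints;
`nu` uncertain variables and `mu` rows in `F`; `ny` recourse variables and `my` rows in `B2`. -/
structure TwoStageRO (mx nx mA nu mu ny my : ℕ) where
  c1 : Fin mx ⊕ Fin nx → ℝ
  A : Matrix (Fin mA) (Fin mx ⊕ Fin nx) ℝ
  b : Fin mA → ℝ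
  F : Matrix (Fin mu) (Fin nu) ℝ
  h : Fin mu → ℝ
  G : Matrix (Fin mu) (Fin mx ⊕ Fin nx) ℝ
  c2 : Fin ny → ℝ
  B1 : Matrix (Fin my) (Fin mx ⊕ Fin nx) ℝ
  B2 : Matrix (Fin my) (Fin ny) ℝ
  d : Fin my → ℝ
  E : Matrix (Fin my) (Fin nu) ℝ

/-- What one iteration of the algorithm records: the first-stage decision `x` taken from the master
problem, the worst-case recourse cost `worst` assigned to it, the extreme point or extreme ray
`beta` of the dual polyhedron, and the optimal basis with its reduced costs `r`. Variables of the
linear program in standard form are indexed by `Fin nu ⊕ Fin mu` (structural, then slack). -/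
structure IterationRecord (mx nx nu mu my : ℕ) where
  x : Fin mx ⊕ Fin nx → ℝ
  worst : EReal
  beta : Fin my → ℝ
  basis : Finset (Fin nu ⊕ Fin mu)
  r : Fin nu ⊕ Fin mu → ℝ

namespace TwoStageRO

variable {mx nx mA nu mu ny my : ℕ} (P : TwoStageRO mx nx mA nu mu ny my)

/-! ### The problem -/

/-- First-stage feasible set: nonnegative, the first `mx` entries integral, `A x ≥ b`. -/
def X : Set (Fin mx ⊕ Fin nx → ℝ) :=
  {x | 0 ≤ x ∧ (∀ i : Fin mx, ∃ k : ℤ, x (Sum.inl i) = k) ∧ P.b ≤ P.A *ᵥ x}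

/-- Right-hand side `h + G x` of the uncertainty set. -/
def rhs (x : Fin mx ⊕ Fin nx → ℝ) : Fin mu → ℝ := P.h + P.G *ᵥ x

/-- The decision-dependent uncertainty set `U(x) = {u ≥ 0 : F u ≤ h + G x}`. -/
def U (x : Fin mx ⊕ Fin nx → ℝ) : Set (Fin nu → ℝ) := {u | 0 ≤ u ∧ P.F *ᵥ u ≤ P.rhs x}

/-- Right-hand side `d - B₁ x - E u` of the recourse problem. -/
def demand (x : Fin mx ⊕ Fin nx → ℝ) (u : Fin nu → ℝ) : Fin my → ℝ :=
  P.d - P.B1 *ᵥ x - P.E *ᵥ u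

/-- Recourse feasible set `Y(x,u)`. -/
def Y (x : Fin mx ⊕ Fin nx → ℝ) (u : Fin nu → ℝ) : Set (Fin ny → ℝ) :=
  {y | 0 ≤ y ∧ P.demand x u ≤ P.B2 *ᵥ y}

/-- Standing assumptions: `U(x)` is nonempty and bounded for every `x ∈ X`, and
`min {c₁ x + c₂ y : x ∈ X, u ∈ U(x), y ∈ Y(x,u)}` has a finite value. -/
def Standing : Prop :=
  (∀ x ∈ P.X, (P.U x).Nonempty) ∧
  (∀ x ∈ P.X, Bornology.IsBounded (P.U x)) ∧
  {w : ℝ | ∃ x ∈ P.X, ∃ u ∈ P.U x, ∃ y ∈ P.Y x u, w = P.c1 ⬝ᵥ x + P.c2 ⬝ᵥ y}.Nonempty ∧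
  BddBelow {w : ℝ | ∃ x ∈ P.X, ∃ u ∈ P.U x, ∃ y ∈ P.Y x u, w = P.c1 ⬝ᵥ x + P.c2 ⬝ᵥ y}

/-! ### Subproblems -/

/-- Optimal value of the recourse problem (`⊤` if it is infeasible). -/
noncomputable def recourse (x : Fin mx ⊕ Fin nx → ℝ) (u : Fin nu → ℝ) : EReal :=
  ⨅ y ∈ P.Y x u, ((P.c2 ⬝ᵥ y : ℝ) : EReal)

/-- Worst-case recourse cost `η_s(x)`, the value of the second subproblem. -/
noncomputable def etaS (x : Fin mx ⊕ Fin nx → ℝ) : EReal := ⨆ u ∈ P.U x, P.recourse x u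

/-- Least total violation of the recourse constraints:
`min {1ᵀ v : B₂ y + v ≥ d - B₁ x - E u, y ≥ 0, v ≥ 0}`. -/
noncomputable def violation (x : Fin mx ⊕ Fin nx → ℝ) (u : Fin nu → ℝ) : EReal :=
  ⨅ p ∈ {p : (Fin ny → ℝ) × (Fin my → ℝ) |
      0 ≤ p.1 ∧ 0 ≤ p.2 ∧ P.demand x u ≤ P.B2 *ᵥ p.1 + p.2},
    ((∑ i, p.2 i : ℝ) : EReal)

/-- Worst-case violation `η_f(x)`, the value of the first subproblem. -/
noncomputable def etaF (x : Fin mx ⊕ Fin nx → ℝ) : EReal := ⨆ u ∈ P.U x, P.violation x u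

/-- The dual polyhedron `Π = {π ≥ 0 : B₂ᵀ π ≤ c₂ᵀ}` of the recourse problem. -/
def dualPolyhedron : Set (Fin my → ℝ) := {p | 0 ≤ p ∧ P.B2ᵀ *ᵥ p ≤ P.c2}

/-- The recession cone of `Π`. -/
def dualCone : Set (Fin my → ℝ) := {g | 0 ≤ g ∧ P.B2ᵀ *ᵥ g ≤ 0}

/-- `g` spans an extreme ray of `Π`. -/
def IsExtremeRay (g : Fin my → ℝ) : Prop :=
  g ∈ P.dualCone ∧ g ≠ 0 ∧
    ∀ p ∈ P.dualCone, ∀ q ∈ P.dualCone, p + q = g → ∃ s : ℝ, 0 ≤ s ∧ p = s • g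

/-! ### The linear program over `U(x)` and its bases -/

/-- Objective coefficients `-Eᵀ β` of `LP(x, β) : max {(-E u)ᵀ β : u ∈ U(x)}`. -/
def lpCost (beta : Fin my → ℝ) : Fin nu → ℝ := -(P.Eᵀ *ᵥ beta)

/-- `u` is an optimal solution of `max {c u : u ∈ U(x)}`. -/
def IsLPOptimal (x : Fin mx ⊕ Fin nx → ℝ) (c u : Fin nu → ℝ) : Prop :=
  u ∈ P.U x ∧ ∀ v ∈ P.U x, c ⬝ᵥ v ≤ c ⬝ᵥ u

/-- The pairs `(u, λ)` that satisfy the KKT conditions of `max {c u : u ∈ U(x)}`. -/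
def kktSet (x : Fin mx ⊕ Fin nx → ℝ) (c : Fin nu → ℝ) : Set ((Fin nu → ℝ) × (Fin mu → ℝ)) :=
  {p | P.F *ᵥ p.1 ≤ P.rhs x ∧ c ≤ P.Fᵀ *ᵥ p.2 ∧
    (∀ i, p.2 i * (P.rhs x - P.F *ᵥ p.1) i = 0) ∧
    (∀ j, p.1 j * (P.Fᵀ *ᵥ p.2 - c) j = 0) ∧
    0 ≤ p.1 ∧ 0 ≤ p.2}

/-- The constraint matrix `[F I]` of the standard form `F u + s = h + G x`, `u, s ≥ 0`. -/
def stdMatrix : Matrix (Fin mu) (Fin nu ⊕ Fin mu) ℝ := Matrix.fromCols P.F 1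

/-- A basis: `mu` linearly independent columns of `[F I]`. -/
def IsBasis (B : Finset (Fin nu ⊕ Fin mu)) : Prop :=
  B.card = mu ∧ LinearIndependent ℝ (fun j : {j // j ∈ B} => fun i => P.stdMatrix i j)

/-- The number of bases; it depends neither on `x` nor on the objective. -/
noncomputable def numBases : ℕ := {B : Finset (Fin nu ⊕ Fin mu) | P.IsBasis B}.ncard

/-- `z` is the basic solution of `B` with respect to `U(x)`. -/
def IsBasicSolution (x : Fin mx ⊕ Fin nx → ℝ) (B : Finset (Fin nu ⊕ Fin mu))
    (z : Fin nu ⊕ Fin mu → ℝ) : Prop :=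
  (∀ j, j ∉ B → z j = 0) ∧ P.stdMatrix *ᵥ z = P.rhs x

/-- `r` is the vector of reduced costs of the objective `k` (on all variables in standard form) at
`B`: `r = k - w [F I]`, where the multipliers `w` are such that `r` vanishes on `B`. -/
def IsReducedCost (B : Finset (Fin nu ⊕ Fin mu)) (k r : Fin nu ⊕ Fin mu → ℝ) : Prop :=
  (∃ w : Fin mu → ℝ, r = k - w ᵥ* P.stdMatrix) ∧ ∀ j ∈ B, r j = 0

/-- `B` is an optimal basis of `max {c u : u ∈ U(x)}` with reduced costs `r`: its basic solution is
feasible and no reduced cost is positive. -/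
def IsOptimalBasis (x : Fin mx ⊕ Fin nx → ℝ) (c : Fin nu → ℝ)
    (B : Finset (Fin nu ⊕ Fin mu)) (r : Fin nu ⊕ Fin mu → ℝ) : Prop :=
  P.IsBasis B ∧ (∃ z, 0 ≤ z ∧ P.IsBasicSolution x B z) ∧
    P.IsReducedCost B (Sum.elim c 0) r ∧ ∀ j, r j ≤ 0

/-- The modified objective on all variables in standard form: the coefficient of a nonbasic variable
with zero reduced cost is lowered by `ε`, all others are kept (slacks start with coefficient 0). -/
noncomputable def modifiedStdCost (ε : ℝ) (c : Fin nu → ℝ) (B : Finset (Fin nu ⊕ Fin mu))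
    (r : Fin nu ⊕ Fin mu → ℝ) : Fin nu ⊕ Fin mu → ℝ :=
  fun j => if j ∉ B ∧ r j = 0 then Sum.elim c 0 j - ε else Sum.elim c 0 j

/-- An objective `k` on all variables in standard form, written as an objective on `u` alone by
substituting `s = h + G x - F u` (up to a constant that does not depend on `u`). -/
def eliminateSlacks (k : Fin nu ⊕ Fin mu → ℝ) : Fin nu → ℝ :=
  (fun j => k (Sum.inl j)) - P.Fᵀ *ᵥ (fun i => k (Sum.inr i))

/-- The modified objective coefficients on `u`. -/
noncomputable def modifiedCost (ε : ℝ) (c : Fin nu → ℝ) (B : Finset (Fin nu ⊕ Fin mu))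
    (r : Fin nu ⊕ Fin mu → ℝ) : Fin nu → ℝ :=
  P.eliminateSlacks (modifiedStdCost ε c B r)

/-! ### The master problem

Iterations are numbered from 0. The cutting set added in iteration `s` is determined by an objective
`cut s` on `u`, whose KKT set it embeds; the master problem of iteration `t` contains the cutting
sets of all iterations `s < t`. Cutting sets are unified: each contains `η ≥ c₂ y`. -/

/-- `(x, η)` can be completed to a feasible solution of the master problem of iteration `t`. -/
def MasterFeasible (cut : ℕ → Fin nu → ℝ) (t : ℕ) (x : Fin mx ⊕ Fin nx → ℝ) (η : ℝ) : Prop :=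
  x ∈ P.X ∧ ∀ s < t, ∃ (u : Fin nu → ℝ) (l : Fin mu → ℝ) (y : Fin ny → ℝ),
    (u, l) ∈ P.kktSet x (cut s) ∧ 0 ≤ y ∧ P.demand x u ≤ P.B2 *ᵥ y ∧ P.c2 ⬝ᵥ y ≤ η

/-- Optimal value of the master problem of iteration `t`, the lower bound `LB` of that iteration. -/
noncomputable def lowerBound (cut : ℕ → Fin nu → ℝ) (t : ℕ) : EReal :=
  ⨅ p ∈ {p : (Fin mx ⊕ Fin nx → ℝ) × ℝ | P.MasterFeasible cut t p.1 p.2},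
    ((P.c1 ⬝ᵥ p.1 + p.2 : ℝ) : EReal)

/-- `x` is the first-stage part of an optimal solution of the master problem of iteration `t`.
If that problem is unbounded, as it is without cutting sets, any feasible `x` may be taken. -/
def SolvesMaster (cut : ℕ → Fin nu → ℝ) (t : ℕ) (x : Fin mx ⊕ Fin nx → ℝ) : Prop :=
  ∃ η : ℝ, P.MasterFeasible cut t x η ∧
    (((P.c1 ⬝ᵥ x + η : ℝ) : EReal) = P.lowerBound cut t ∨ P.lowerBound cut t = ⊥)

/-! ### Iterations and runs -/

/-- Feasible case (`η_f(x) = 0`): there is a worst-case scenario `u`, and `beta` is an extreme point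
of `Π` that is an optimal dual solution of the recourse problem for `u`
(it attains the recourse value `η_s(x)`). -/
def CaseA (R : IterationRecord mx nx nu mu my) : Prop :=
  P.etaF R.x = 0 ∧ R.worst = P.etaS R.x ∧
    ∃ u ∈ P.U R.x, P.recourse R.x u = P.etaS R.x ∧
      R.beta ∈ Set.extremePoints ℝ P.dualPolyhedron ∧
      ((P.demand R.x u ⬝ᵥ R.beta : ℝ) : EReal) = P.etaS R.x

/-- Infeasible case (`η_f(x) > 0`): for an optimal scenario `u` of the first subproblem, `beta` is an
extreme ray of `Π` along which the dual of the recourse problem is unbounded. -/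
def CaseB (R : IterationRecord mx nx nu mu my) : Prop :=
  0 < P.etaF R.x ∧ R.worst = ⊤ ∧
    ∃ u ∈ P.U R.x, P.violation R.x u = P.etaF R.x ∧
      P.IsExtremeRay R.beta ∧ 0 < P.demand R.x u ⬝ᵥ R.beta

/-- The subproblem steps of an iteration, including the extraction of an optimal basis (and its
reduced costs) of `LP(x, beta)`. -/
def SolvesSubproblems (R : IterationRecord mx nx nu mu my) : Prop :=
  (P.CaseA R ∨ P.CaseB R) ∧ P.IsOptimalBasis R.x (P.lpCost R.beta) R.basis R.r

/-- The upper bound `UB` after the first `t` iterations. -/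
noncomputable def upperBound (log : ℕ → IterationRecord mx nx nu mu my) : ℕ → EReal
  | 0 => ⊤
  | t + 1 => min (upperBound log t) (((P.c1 ⬝ᵥ (log t).x : ℝ) : EReal) + (log t).worst)

/-- Iterations `0, …, T - 1`, as recorded in `log`, are carried out correctly and the algorithm
terminates in none of them: the master problem is feasible (and solved), the subproblems are solved,
and afterwards the test `UB - LB ≤ tol` fails. -/
def RunsWithoutTermination (tol : ℝ) (cut : ℕ → Fin nu → ℝ)
    (log : ℕ → IterationRecord mx nx nu mu my) (T : ℕ) : Prop :=
  ∀ t < T, P.SolvesMaster cut t (log t).x ∧ P.SolvesSubproblems (log t) ∧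
    ¬ P.upperBound log (t + 1) ≤ P.lowerBound cut t + (tol : EReal)

/-- Variant 2 completes `T` iterations without terminating: the cutting set of an iteration embeds
the KKT set of `LP(x, beta)` for the recorded `beta`. -/
def Variant2Runs (tol : ℝ) (log : ℕ → IterationRecord mx nx nu mu my) (T : ℕ) : Prop :=
  P.RunsWithoutTermination tol (fun t => P.lpCost (log t).beta) log T

/-- The modified Variant 2 completes `T` iterations without terminating: the cutting set of an
iteration embeds the KKT set for the modified objective instead. -/
def ModifiedVariant2Runs (tol : ℝ) (ε : ℕ → ℝ) (log : ℕ → IterationRecord mx nx nu mu my)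
    (T : ℕ) : Prop :=
  P.RunsWithoutTermination tol
    (fun t => P.modifiedCost (ε t) (P.lpCost (log t).beta) (log t).basis (log t).r) log T

/-- The unique optimal solution property during the first `T` iterations: at the decision `x` of each
iteration, `LP(x, beta)` has a unique optimal solution for every `beta` identified so far
(in this iteration or an earlier one). -/
def UniqueOptimalSolutions (log : ℕ → IterationRecord mx nx nu mu my) (T : ℕ) : Prop :=
  ∀ t < T, ∀ s ≤ t, ∃! u, P.IsLPOptimal (log t).x (P.lpCost (log s).beta) u

end TwoStageRO

namespace TwoStageRO

variable {mx nx mA nu mu ny my : ℕ} {P : TwoStageRO mx nx mA nu mu ny my}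

/-! ### Weak duality of the recourse problem -/

/-! No basis is extracted twice before termination, so iterations inject into bases. The decision
enters `U(x)` only through the right-hand side, so reduced costs depend on the basis and the
objective but not on `x`. Suppose iterations `s < t` extract the same basis `B`. Its basic solution
`z` at the decision of `t` is feasible, hence optimal there for the `beta` of `s` as well as that of
`t` (`IsBasicSolution.isLPOptimal_of_isOptimalBasis`). The KKT system in the cutting set of `s`
forces its `u` to be `z`: in (a) by the uniqueness assumption, in (b) because the modified objective
makes every nonbasic reduced cost negative (`IsLPOptimal.eq_of_reducedCost_neg`). So that `u` is
optimal for the new `beta`, and weak duality for the `y` of the cutting set shows that the master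
value already covers the worst-case cost (`worst_le_lowerBound`): the stopping test succeeds. -/

/-- The bound `c` is left free: `c = c2` serves extreme points of `Π`, `c = 0` extreme rays. -/
theorem demand_dotProduct_le {x : Fin mx ⊕ Fin nx → ℝ} {u : Fin nu → ℝ} {y : Fin ny → ℝ}
    (hy : y ∈ P.Y x u) {p : Fin my → ℝ} (hp : 0 ≤ p) {c : Fin ny → ℝ} (hc : P.B2ᵀ *ᵥ p ≤ c) :
    P.demand x u ⬝ᵥ p ≤ c ⬝ᵥ y :=
  calc P.demand x u ⬝ᵥ p ≤ (P.B2 *ᵥ y) ⬝ᵥ p := dotProduct_le_dotProduct_of_nonneg_right hy.2 hp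
    _ = (P.B2ᵀ *ᵥ p) ⬝ᵥ y := by
      rw [dotProduct_comm, dotProduct_mulVec, mulVec_transpose]
    _ ≤ c ⬝ᵥ y := dotProduct_le_dotProduct_of_nonneg_right hc hy.1

theorem demand_dotProduct_eq (x : Fin mx ⊕ Fin nx → ℝ) (u : Fin nu → ℝ) (p : Fin my → ℝ) :
    P.demand x u ⬝ᵥ p = (P.d - P.B1 *ᵥ x) ⬝ᵥ p + P.lpCost p ⬝ᵥ u := by
  have h : (P.E *ᵥ u) ⬝ᵥ p = (P.Eᵀ *ᵥ p) ⬝ᵥ u := by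
    rw [dotProduct_comm, dotProduct_mulVec, mulVec_transpose]
  rw [demand, lpCost, sub_dotProduct, h, neg_dotProduct, sub_eq_add_neg]

/-- An optimal solution of `LP(x, p)` maximizes the dual objective `demand x u ⬝ᵥ p` over `U(x)`. -/
theorem IsLPOptimal.demand_dotProduct_le {x : Fin mx ⊕ Fin nx → ℝ} {p : Fin my → ℝ}
    {u v : Fin nu → ℝ} (hu : P.IsLPOptimal x (P.lpCost p) u) (hv : v ∈ P.U x) :
    P.demand x v ⬝ᵥ p ≤ P.demand x u ⬝ᵥ p := by
  rw [demand_dotProduct_eq, demand_dotProduct_eq]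
  exact add_le_add_right (hu.2 v hv) _

/-! ### Linear programs over `U(x)` -/

/-- Complementary slackness gives `c u = λ (F u) = λ (h + G x)`, which by dual feasibility of `λ`
bounds `c v` for every `v` in `U(x)`. -/
theorem isLPOptimal_of_mem_kktSet {x : Fin mx ⊕ Fin nx → ℝ} {c u : Fin nu → ℝ} {l : Fin mu → ℝ}
    (h : (u, l) ∈ P.kktSet x c) : P.IsLPOptimal x c u := by
  obtain ⟨hF, hc, hl, hu, hu0, hl0⟩ := h
  refine ⟨⟨hu0, hF⟩, fun v hv => ?_⟩
  have hl' : l ⬝ᵥ (P.rhs x - P.F *ᵥ u) = 0 := Finset.sum_eq_zero fun i _ => hl i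
  have hu' : u ⬝ᵥ (P.Fᵀ *ᵥ l - c) = 0 := Finset.sum_eq_zero fun j _ => hu j
  have adj : ∀ w : Fin nu → ℝ, (P.Fᵀ *ᵥ l) ⬝ᵥ w = l ⬝ᵥ (P.F *ᵥ w) := fun w => by
    rw [dotProduct_mulVec, mulVec_transpose]
  have h1 : c ⬝ᵥ v ≤ (P.Fᵀ *ᵥ l) ⬝ᵥ v := dotProduct_le_dotProduct_of_nonneg_right hc hv.1
  have h2 : l ⬝ᵥ (P.F *ᵥ v) ≤ l ⬝ᵥ P.rhs x := dotProduct_le_dotProduct_of_nonneg_left hv.2 hl0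
  rw [dotProduct_sub] at hl' hu'
  rw [adj] at h1
  rw [dotProduct_comm u, adj, dotProduct_comm u] at hu'
  linarith

theorem stdMatrix_mulVec (z : Fin nu ⊕ Fin mu → ℝ) :
    P.stdMatrix *ᵥ z = P.F *ᵥ (z ∘ Sum.inl) + z ∘ Sum.inr := by
  rw [stdMatrix, fromCols_mulVec, one_mulVec]

/-- The standard-form point of `u`: structural variables `u` and their slacks. -/
def stdPoint (P : TwoStageRO mx nx mA nu mu ny my) (x : Fin mx ⊕ Fin nx → ℝ) (u : Fin nu → ℝ) :
    Fin nu ⊕ Fin mu → ℝ :=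
  Sum.elim u (P.rhs x - P.F *ᵥ u)

theorem stdPoint_nonneg {x : Fin mx ⊕ Fin nx → ℝ} {u : Fin nu → ℝ} (hu : u ∈ P.U x) :
    0 ≤ P.stdPoint x u := by
  rintro (j | i)
  · exact hu.1 j
  · exact sub_nonneg.2 (hu.2 i)

theorem stdMatrix_mulVec_stdPoint (x : Fin mx ⊕ Fin nx → ℝ) (u : Fin nu → ℝ) :
    P.stdMatrix *ᵥ P.stdPoint x u = P.rhs x := by
  rw [stdMatrix_mulVec, stdPoint, Sum.elim_comp_inl, Sum.elim_comp_inr, add_sub_cancel]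

theorem stdPoint_of_mulVec_eq {x : Fin mx ⊕ Fin nx → ℝ} {z : Fin nu ⊕ Fin mu → ℝ}
    (hz : P.stdMatrix *ᵥ z = P.rhs x) : P.stdPoint x (z ∘ Sum.inl) = z := by
  rw [stdPoint, ← hz, stdMatrix_mulVec, add_sub_cancel_left, Sum.elim_comp_inl_inr]

theorem mem_U_of_nonneg {x : Fin mx ⊕ Fin nx → ℝ} {z : Fin nu ⊕ Fin mu → ℝ} (hz0 : 0 ≤ z)
    (hz : P.stdMatrix *ᵥ z = P.rhs x) : z ∘ Sum.inl ∈ P.U x := by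
  refine ⟨fun j => hz0 _, fun i => ?_⟩
  rw [← hz, stdMatrix_mulVec]
  exact le_add_of_nonneg_right (hz0 _)

theorem eliminateSlacks_dotProduct (k : Fin nu ⊕ Fin mu → ℝ) (x : Fin mx ⊕ Fin nx → ℝ)
    (u : Fin nu → ℝ) :
    P.eliminateSlacks k ⬝ᵥ u = k ⬝ᵥ P.stdPoint x u - (k ∘ Sum.inr) ⬝ᵥ P.rhs x := by
  have h1 : k ⬝ᵥ P.stdPoint x u =
      (k ∘ Sum.inl) ⬝ᵥ u + (k ∘ Sum.inr) ⬝ᵥ (P.rhs x - P.F *ᵥ u) := by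
    conv_lhs => rw [← Sum.elim_comp_inl_inr k]
    rw [stdPoint, sumElim_dotProduct_sumElim]
  have h2 : P.eliminateSlacks k ⬝ᵥ u =
      (k ∘ Sum.inl) ⬝ᵥ u - (k ∘ Sum.inr) ⬝ᵥ (P.F *ᵥ u) := by
    rw [dotProduct_mulVec, ← mulVec_transpose, ← sub_dotProduct]
    rfl
  rw [h1, h2, dotProduct_sub]
  ring

theorem eliminateSlacks_elim_zero (c : Fin nu → ℝ) : P.eliminateSlacks (Sum.elim c 0) = c := by
  funext j
  simp [eliminateSlacks, mulVec, dotProduct]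

/-- On `U(x)` an objective and its reduced costs differ by a constant. -/
theorem IsReducedCost.exists_dotProduct_eq {B : Finset (Fin nu ⊕ Fin mu)}
    {k r : Fin nu ⊕ Fin mu → ℝ} (h : P.IsReducedCost B k r) (x : Fin mx ⊕ Fin nx → ℝ) :
    ∃ a : ℝ, ∀ u, P.eliminateSlacks k ⬝ᵥ u = r ⬝ᵥ P.stdPoint x u + a := by
  obtain ⟨⟨w, rfl⟩, -⟩ := h
  refine ⟨w ⬝ᵥ P.rhs x - (k ∘ Sum.inr) ⬝ᵥ P.rhs x, fun u => ?_⟩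
  rw [eliminateSlacks_dotProduct k x, sub_dotProduct, ← dotProduct_mulVec,
    stdMatrix_mulVec_stdPoint]
  ring

theorem IsBasicSolution.dotProduct_eq_zero {x : Fin mx ⊕ Fin nx → ℝ}
    {B : Finset (Fin nu ⊕ Fin mu)} {z r : Fin nu ⊕ Fin mu → ℝ} (hz : P.IsBasicSolution x B z)
    (hr : ∀ j ∈ B, r j = 0) : r ⬝ᵥ z = 0 := by
  refine Finset.sum_eq_zero fun j _ => ?_
  by_cases hj : j ∈ B
  · rw [hr j hj, zero_mul]
  · rw [hz.1 j hj, mul_zero]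

/-- Up to a constant the objective is `r` applied to the standard-form point; this is nonpositive on
`U(x)` and zero at `z`. -/
theorem IsBasicSolution.isLPOptimal {x : Fin mx ⊕ Fin nx → ℝ} {B : Finset (Fin nu ⊕ Fin mu)}
    {z k r : Fin nu ⊕ Fin mu → ℝ} (hz : P.IsBasicSolution x B z) (hz0 : 0 ≤ z)
    (hr : P.IsReducedCost B k r) (hr0 : ∀ j, r j ≤ 0) :
    P.IsLPOptimal x (P.eliminateSlacks k) (z ∘ Sum.inl) := by
  refine ⟨mem_U_of_nonneg hz0 hz.2, fun v hv => ?_⟩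
  obtain ⟨a, ha⟩ := hr.exists_dotProduct_eq x
  rw [ha, ha, stdPoint_of_mulVec_eq hz.2, hz.dotProduct_eq_zero hr.2]
  refine add_le_add_left (Finset.sum_nonpos fun j _ => ?_) a
  exact mul_nonpos_of_nonpos_of_nonneg (hr0 j) (stdPoint_nonneg hv j)

/-- The difference of two basic solutions is a linear relation among the independent columns in `B`.
-/
theorem IsBasicSolution.unique {x : Fin mx ⊕ Fin nx → ℝ} {B : Finset (Fin nu ⊕ Fin mu)}
    {z z' : Fin nu ⊕ Fin mu → ℝ} (hB : P.IsBasis B) (hz : P.IsBasicSolution x B z)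
    (hz' : P.IsBasicSolution x B z') : z = z' := by
  have hli := Fintype.linearIndependent_iff.1 hB.2 (fun j => z j - z' j) <| by
    funext i
    have h0 : (P.stdMatrix *ᵥ (z - z')) i = 0 := by
      rw [mulVec_sub, hz.2, hz'.2, sub_self, Pi.zero_apply]
    rw [Finset.sum_apply, Pi.zero_apply, ← h0, mulVec, dotProduct]
    have h1 := Finset.sum_coe_sort B fun j => P.stdMatrix i j * (z - z') j
    rw [← Finset.sum_subset (Finset.subset_univ B), ← h1]
    · exact Finset.sum_congr rfl fun j _ => mul_comm _ _
    · intro j _ hj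
      rw [Pi.sub_apply, hz.1 j hj, hz'.1 j hj, sub_zero, mul_zero]
  funext j
  by_cases hj : j ∈ B
  · exact sub_eq_zero.1 (hli ⟨j, hj⟩)
  · rw [hz.1 j hj, hz'.1 j hj]

/-- If all nonbasic reduced costs are negative, then the basic solution is the only optimal one. -/
theorem IsLPOptimal.eq_of_reducedCost_neg {x : Fin mx ⊕ Fin nx → ℝ}
    {B : Finset (Fin nu ⊕ Fin mu)} {z k r : Fin nu ⊕ Fin mu → ℝ} {u : Fin nu → ℝ}
    (hu : P.IsLPOptimal x (P.eliminateSlacks k) u) (hB : P.IsBasis B)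
    (hz : P.IsBasicSolution x B z) (hz0 : 0 ≤ z) (hr : P.IsReducedCost B k r)
    (hneg : ∀ j, j ∉ B → r j < 0) : u = z ∘ Sum.inl := by
  obtain ⟨a, ha⟩ := hr.exists_dotProduct_eq x
  have hle := hu.2 _ (mem_U_of_nonneg hz0 hz.2)
  rw [ha, ha, stdPoint_of_mulVec_eq hz.2, hz.dotProduct_eq_zero hr.2, add_le_add_iff_right] at hle
  have hterm : ∀ j ∈ Finset.univ, r j * P.stdPoint x u j ≤ 0 := fun j _ => by
    refine mul_nonpos_of_nonpos_of_nonneg ?_ (stdPoint_nonneg hu.1 j)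
    by_cases hj : j ∈ B
    · exact (hr.2 j hj).le
    · exact (hneg j hj).le
  -- Optimality forces a sum of nonpositive terms to be zero, so each term vanishes and the nonbasic
  -- coordinates of `u` are zero.
  have hzero := (Finset.sum_eq_zero_iff_of_nonpos hterm).1 (le_antisymm (Finset.sum_nonpos hterm) hle)
  have hbasic : P.IsBasicSolution x B (P.stdPoint x u) :=
    ⟨fun j hj => (mul_eq_zero.1 (hzero j (Finset.mem_univ j))).resolve_left (hneg j hj).ne,
      stdMatrix_mulVec_stdPoint x u⟩
  rw [← hbasic.unique hB hz]
  rfl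

/-- Lowering the coefficients of nonbasic variables lowers their reduced costs. -/
theorem IsReducedCost.modified {B : Finset (Fin nu ⊕ Fin mu)} {c : Fin nu → ℝ}
    {r : Fin nu ⊕ Fin mu → ℝ} (h : P.IsReducedCost B (Sum.elim c 0) r) (ε : ℝ) :
    P.IsReducedCost B (modifiedStdCost ε c B r)
      (fun j => if j ∉ B ∧ r j = 0 then r j - ε else r j) := by
  obtain ⟨⟨w, hw⟩, h0⟩ := h
  -- The same multipliers `w` work, since the coefficients on `B` are untouched.
  refine ⟨⟨w, funext fun j => ?_⟩, fun j hj => ?_⟩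
  · have hj := congrFun hw j
    simp only [Pi.sub_apply] at hj
    simp only [modifiedStdCost, Pi.sub_apply]
    split_ifs <;> linarith
  · exact (if_neg fun hn => hn.1 hj).trans (h0 j hj)

/-! ### Termination -/

/-- A single cutting set supplies `u` and `y` feasible for the joint minimization over `x`, `u`,
`y`, whose finite value then bounds the master problem from below. -/
theorem Standing.lowerBound_ne_bot (hP : P.Standing) (cut : ℕ → Fin nu → ℝ) {s t : ℕ}
    (hst : s < t) : P.lowerBound cut t ≠ ⊥ := by
  obtain ⟨m, hm⟩ := hP.2.2.2
  refine ne_of_gt (lt_of_lt_of_le (EReal.bot_lt_coe m) ?_)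
  refine le_iInf₂ fun p hp => EReal.coe_le_coe_iff.2 ?_
  obtain ⟨hx, hcut⟩ := hp
  obtain ⟨u, l, y, hk, hy0, hy, hc⟩ := hcut s hst
  exact (hm ⟨p.1, hx, u, (isLPOptimal_of_mem_kktSet hk).1, y, ⟨hy0, hy⟩, rfl⟩).trans
    (add_le_add_right hc _)

/-- If the KKT points of an earlier cutting set at the current decision are optimal for the newly
identified `beta`, then the current lower bound reaches the current upper bound. -/
theorem worst_le_lowerBound (hP : P.Standing) {cut : ℕ → Fin nu → ℝ} {s t : ℕ} (hst : s < t)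
    {R : IterationRecord mx nx nu mu my} (hM : P.SolvesMaster cut t R.x)
    (hR : P.CaseA R ∨ P.CaseB R)
    (hopt : ∀ u, P.IsLPOptimal R.x (cut s) u → P.IsLPOptimal R.x (P.lpCost R.beta) u) :
    ((P.c1 ⬝ᵥ R.x : ℝ) : EReal) + R.worst ≤ P.lowerBound cut t := by
  obtain ⟨η, hfeas, hLB⟩ := hM
  -- With a cutting set present, the unbounded case is excluded and `(R.x, η)` attains the lower
  -- bound.
  rw [← hLB.resolve_right (hP.lowerBound_ne_bot cut hst), EReal.coe_add]
  obtain ⟨u, l, y, hk, hy0, hy, hc⟩ := hfeas.2 s hst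
  have hu := hopt u (isLPOptimal_of_mem_kktSet hk)
  rcases hR with ⟨-, hworst, v, hv, -, hbeta, hval⟩ | ⟨-, -, v, hv, -, hbeta, hpos⟩
  · refine add_le_add_right ?_ _
    rw [hworst, ← hval, EReal.coe_le_coe_iff]
    exact (hu.demand_dotProduct_le hv).trans
      ((demand_dotProduct_le ⟨hy0, hy⟩ hbeta.1.1 hbeta.1.2).trans hc)
  -- The infeasible case is contradictory: a recourse solution at `u` makes the ray's value
  -- nonpositive there, while `u` maximizes that value and it is positive at `v`.
  · have h := demand_dotProduct_le (P := P) (x := R.x) ⟨hy0, hy⟩ hbeta.1.1 hbeta.1.2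
    rw [zero_dotProduct] at h
    exact absurd (hpos.trans_le (hu.demand_dotProduct_le hv)) h.not_gt

/-- A run whose cutting sets decide the newly identified `beta` as soon as a basis is repeated
never repeats a basis. -/
theorem RunsWithoutTermination.le_numBases (hP : P.Standing) {tol : ℝ} (htol : 0 ≤ tol)
    {cut : ℕ → Fin nu → ℝ} {log : ℕ → IterationRecord mx nx nu mu my} {T : ℕ}
    (hrun : P.RunsWithoutTermination tol cut log T)
    (hopt : ∀ s t, s < t → t < T → (log s).basis = (log t).basis → ∀ u,
      P.IsLPOptimal (log t).x (cut s) u → P.IsLPOptimal (log t).x (P.lpCost (log t).beta) u) :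
    T ≤ P.numBases := by
  have hne : ∀ s t, s < t → t < T → (log s).basis ≠ (log t).basis := fun s t hst ht heq => by
    obtain ⟨hM, hS, htest⟩ := hrun t ht
    refine htest ((min_le_right _ _).trans ?_)
    exact (worst_le_lowerBound hP hst hM hS.1 (hopt s t hst ht heq)).trans
      (le_add_of_nonneg_right (EReal.coe_nonneg.2 htol))
  have hinj : Set.InjOn (fun t => (log t).basis) (Finset.range T : Set ℕ) := by
    intro s hs t ht heq
    rw [Finset.mem_coe, Finset.mem_range] at hs ht
    rcases lt_trichotomy s t with h | h | h
    · exact absurd heq (hne s t h ht)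
    · exact h
    · exact absurd heq.symm (hne t s h hs)
  calc T = (Finset.range T : Set ℕ).ncard := by rw [Set.ncard_coe_finset, Finset.card_range]
    _ ≤ P.numBases := Set.ncard_le_ncard_of_injOn (fun t => (log t).basis)
      (fun t ht => (hrun t (Finset.mem_range.1 ht)).2.1.2.1) hinj (Set.toFinite _)

theorem numBases_le (P : TwoStageRO mx nx mA nu mu ny my) : P.numBases ≤ (nu + mu).choose mu := by
  have h : {B : Finset (Fin nu ⊕ Fin mu) | P.IsBasis B} ⊆
      (Finset.powersetCard mu Finset.univ : Finset (Finset (Fin nu ⊕ Fin mu))) := fun B hB =>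
    Finset.mem_coe.2 (Finset.mem_powersetCard.2 ⟨Finset.subset_univ B, hB.1⟩)
  refine (Set.ncard_le_ncard h (Finset.finite_toSet _)).trans_eq ?_
  rw [Set.ncard_coe_finset, Finset.card_powersetCard, Finset.card_univ, Fintype.card_sum,
    Fintype.card_fin, Fintype.card_fin]

/-- Transfer between decisions: `x'` is where the basis was extracted, `x` where it is reused. Only
primal feasibility depends on the decision, and `hz0` supplies it at `x`. -/
theorem IsBasicSolution.isLPOptimal_of_isOptimalBasis {x x' : Fin mx ⊕ Fin nx → ℝ}
    {B : Finset (Fin nu ⊕ Fin mu)} {z r : Fin nu ⊕ Fin mu → ℝ} {c : Fin nu → ℝ}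
    (hz : P.IsBasicSolution x B z) (hz0 : 0 ≤ z) (hB : P.IsOptimalBasis x' c B r) :
    P.IsLPOptimal x c (z ∘ Sum.inl) := by
  have h := hz.isLPOptimal hz0 hB.2.2.1 hB.2.2.2
  rwa [eliminateSlacks_elim_zero] at h

end TwoStageRO

theorem mainTheorem6 {mx nx mA nu mu ny my : ℕ} (P : TwoStageRO mx nx mA nu mu ny my)
    (hP : P.Standing) (tol : ℝ) (htol : 0 ≤ tol) :
    (∀ (log : ℕ → IterationRecord mx nx nu mu my) (T : ℕ),
      P.Variant2Runs tol log T → P.UniqueOptimalSolutions log T → T ≤ P.numBases) ∧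
    (∀ (ε : ℕ → ℝ) (log : ℕ → IterationRecord mx nx nu mu my) (T : ℕ), (∀ t, 0 < ε t) →
      P.ModifiedVariant2Runs tol ε log T → T ≤ P.numBases) ∧
    P.numBases ≤ (nu + mu).choose mu := by
  refine ⟨fun log T hrun huniq => ?_, fun ε log T hε hrun => ?_, P.numBases_le⟩
  · refine TwoStageRO.RunsWithoutTermination.le_numBases hP htol hrun fun s t hst ht heq u hu => ?_
    have hBt := (hrun t ht).2.1.2
    have hBs := (hrun s (hst.trans ht)).2.1.2
    rw [heq] at hBs
    obtain ⟨z, hz0, hz⟩ := hBt.2.1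
    -- Both `u` and the basic solution solve the linear program of the earlier `beta` at the current
    -- decision.
    rw [(huniq t ht s hst.le).unique hu (hz.isLPOptimal_of_isOptimalBasis hz0 hBs)]
    exact hz.isLPOptimal_of_isOptimalBasis hz0 hBt
  · refine TwoStageRO.RunsWithoutTermination.le_numBases hP htol hrun fun s t hst ht heq u hu => ?_
    have hBt := (hrun t ht).2.1.2
    have hBs := (hrun s (hst.trans ht)).2.1.2
    obtain ⟨z, hz0, hz⟩ := hBt.2.1
    rw [← heq] at hz
    rw [hu.eq_of_reducedCost_neg hBs.1 hz hz0 (hBs.2.2.1.modified (ε s)) fun j hj => ?_]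
    · rw [heq] at hz
      exact hz.isLPOptimal_of_isOptimalBasis hz0 hBt
    -- A nonbasic reduced cost is either zero, and lowered to `-ε s`, or already negative.
    · have hεs := hε s
      have hrj := hBs.2.2.2 j
      split_ifs with h
      · linarith
      · exact lt_of_le_of_ne hrj fun h0 => h ⟨hj, h0⟩
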